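/- Let $q$ be a prime power, $k\ge 2$, $r\ge 2$ and $n=(2r+1)k$, and consider $\mathbb F_q\subset\mathbb F_{q^k}\subset\mathbb F_{q^n}$. Let $\xi$ be a primitive element of $\mathbb F_{q^k}$ (a generator of $\mathbb F_{q^k}^*$), let $\gamma\in\mathbb F_{q^n}$ be a root of an irreducible polynomial of degree $2r+1$ over $\mathbb F_{q^k}$, let $H=\{1,\xi,\dots,\xi^{q-2}\}$ and $p_0=\max\{i\ge 1:\lfloor r/i\rfloor>\lfloor r/(i+1)\rfloor\}$. For $1\le p\le p_0$ let $L_1=\{1,\dots,r\}$ and, if $p\ge 2$, $L_p=\{\lfloor r/(p+1)\rfloor+1,\dots,\lfloor r/p\rfloor\}$. For $\delta=(\delta_1,\dots,\delta_r)\in(\mathbb F_{q^k}^*)^r$ and $\theta\in H$ define the $\mathbb F_q$-subspaces of $\mathbb F_{q^n}$ $$U^p_{\delta,\theta,l}=\Big\{u+\sum_{a=1}^{p}(\theta u^q+u)\,\delta_{al}\gamma^{al}+\sum_{1\le b\le r,\ b\notin\{l,2l,\dots,pl\}}u\,\delta_b\gamma^b : u\in\mathbb F_{q^k}\Big\}\qquad(1\le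 p\le p_0,\ l\in L_p),$$ $$V_{\delta,l}=\Big\{v+v^q\gamma^l+\sum_{1\le b\le r,\ b\ne l}v\,\delta_b\gamma^b : v\in\mathbb F_{q^k}\Big\}\qquad(1\le l\le r).$$ A subspace $U\subseteq\mathbb F_{q^n}$ is a Sidon space if for all nonzero $a,b,c,d\in U$ with $ab=cd$ one has $\{a\mathbb F_q,b\mathbb F_q\}=\{c\mathbb F_q,d\mathbb F_q\}$. A cyclic $(n,d,k)_q$ constant-dimension code is a nonempty set $\mathcal C$ of $k$-dimensional $\mathbb F_q$-subspaces of $\mathbb F_{q^n}$ with $\alpha U\in\mathcal C$ for all $U\in\mathcal C$, $\alpha\in\mathbb F_{q^n}^*$, whose minimum distance $\min\{\dim U+\dim V-2\dim(U\cap V):U,V\in\mathcal C,\ U\ne V\}$ equals $d$. **Theorem.** All $U^p_{\delta,\theta,l}$ and $V_{\delta,l}$ above are Sidon spaces, and the union of their orbits, $$\mathcal C=\bigcup_{p=1}^{p_0}\ \bigcup_{l\in L_p}\ \bigcup_{\delta}\ \bigcup_{\theta\in H}\{\alpha U^p_{\delta,\theta,l}:\alpha\in\mathbb F_{q^n}^*\}\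 \cup\ \bigcup_{l=1}^{r}\ \bigcup_{\delta}\{\alpha V_{\delta,l}:\alpha\in\mathbb F_{q^n}^*\},$$ is a cyclic $(n,2k-2,k)_q$ constant-dimension code of size $$\frac{\Big(\big(r+\sum_{i=2}^{p_0}(\lfloor r/i\rfloor-\lfloor r/(i+1)\rfloor)\big)(q^k-1)(q-1)+r\Big)(q^k-1)^{r-1}(q^n-1)}{q-1}.$$ -/

import Mathlib

/-- For an extension `K` of the finite field `F` with `q` elements, `x ↦ x ^ q` is additive. -/
theorem qpow_add (F : Type*) {K : Type*} [Field F] [Finite F] [Field K] [Algebra F K] (x y : K) :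
    (x + y) ^ Nat.card F = x ^ Nat.card F + y ^ Nat.card F := by
  cases nonempty_fintype F
  rw [Nat.card_eq_fintype_card]
  exact map_add (FiniteField.frobeniusAlgHom F K) x y

/-- For an extension `K` of the finite field `F` with `q` elements, `x ↦ x ^ q` is `F`-linear. -/
theorem qpow_smul {F K : Type*} [Field F] [Finite F] [Field K] [Algebra F K] (c : F) (x : K) :
    (c • x) ^ Nat.card F = c • x ^ Nat.card F := by
  cases nonempty_fintype F
  rw [Nat.card_eq_fintype_card]
  exact map_smul (FiniteField.frobeniusAlgHom F K) c x

section Codes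

variable {F L : Type*} [Field F] [Field L] [Algebra F L]

/-- The subspace distance `dim U + dim V - 2 dim (U ∩ V)`. -/
noncomputable def subspaceDist (U V : Submodule F L) : ℤ :=
  (Module.finrank F U : ℤ) + Module.finrank F V
    - 2 * Module.finrank F (U ⊓ V : Submodule F L)

/-- The cyclic shift `α U = {α u : u ∈ U}`. -/
def cyclicShift (α : L) (U : Submodule F L) : Submodule F L :=
  U.map (LinearMap.mulLeft F α)

/-- The orbit `{α U : α ∈ Lˣ}` of `U`. -/
def cyclicOrbit (U : Submodule F L) : Set (Submodule F L) :=
  {W | ∃ α : L, α ≠ 0 ∧ W = cyclicShift α U}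

/-- A Sidon space: the product of two nonzero elements determines the factors up to order and
multiplication by scalars from `F`; `span F {a}` is the line `a F`. -/
def IsSidonSpace (U : Submodule F L) : Prop :=
  ∀ a ∈ U, ∀ b ∈ U, ∀ c ∈ U, ∀ d ∈ U, a ≠ 0 → b ≠ 0 → c ≠ 0 → d ≠ 0 → a * b = c * d →
    ({Submodule.span F {a}, Submodule.span F {b}} : Set (Submodule F L)) =
      {Submodule.span F {c}, Submodule.span F {d}}

/-- `C` is a cyclic `(n, d, k)_q` constant-dimension code, the ambient space `𝔽_q ^ n` being
the extension field `L` of the field `F` with `q` elements. -/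
structure IsCyclicCDC (q n : ℕ) (d : ℤ) (k : ℕ) (C : Set (Submodule F L)) : Prop where
  card_eq : Nat.card F = q
  finrank_eq : Module.finrank F L = n
  nonempty : C.Nonempty
  dim_eq : ∀ U ∈ C, Module.finrank F U = k
  minDist : IsLeast {m : ℤ | ∃ U ∈ C, ∃ V ∈ C, U ≠ V ∧ m = subspaceDist U V} d
  cyclic : ∀ U ∈ C, ∀ α : L, α ≠ 0 → cyclicShift α U ∈ C

end Codes

section Construction

variable (F : Type*) {K L : Type*} [Field F] [Finite F] [Field K] [Field L]
  [Algebra F K] [Algebra K L] [Algebra F L] [IsScalarTower F K L]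

/-- The indices `b ∈ {1, …, r}` with `b ∉ {l, 2 l, …, p l}`. -/
def nonMultiples (r p l : ℕ) : Finset ℕ :=
  Finset.Icc 1 r \ (Finset.Icc 1 p).image fun a => a * l

/-- The subspace
`{u + ∑_{a = 1}^p (θ u^q + u) δ_{a l} γ^{a l} + ∑_{b ≤ r, b ∉ {l, …, p l}} u δ_b γ^b : u ∈ K}`.
The parameters `δ_1, …, δ_r` are the values at `1, …, r` of a sequence `δ`; the others do not
occur when `p * l ≤ r`. -/
def subspaceU (r p l : ℕ) (δ : ℕ → Kˣ) (θ : K) (γ : L) : Submodule F L where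
  carrier := {x | ∃ u : K, x = algebraMap K L u
    + ∑ a ∈ Finset.Icc 1 p, ((θ * u ^ Nat.card F + u) * (δ (a * l) : K)) • γ ^ (a * l)
    + ∑ b ∈ nonMultiples r p l, (u * (δ b : K)) • γ ^ b}
  zero_mem' := ⟨0, by simp [Nat.card_pos.ne']⟩
  add_mem' := by
    rintro _ _ ⟨u, rfl⟩ ⟨v, rfl⟩
    refine ⟨u + v, ?_⟩
    have h (b : ℕ) : (θ * (u + v) ^ Nat.card F + (u + v)) * (δ b : K)
        = (θ * u ^ Nat.card F + u) * (δ b : K) + (θ * v ^ Nat.card F + v) * (δ b : K) := by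
      rw [qpow_add]; ring
    simp only [h, add_mul, add_smul, Finset.sum_add_distrib, map_add]
    ring
  smul_mem' := by
    rintro c _ ⟨u, rfl⟩
    refine ⟨c • u, ?_⟩
    have h (b : ℕ) : (θ * (c • u) ^ Nat.card F + c • u) * (δ b : K)
        = c • ((θ * u ^ Nat.card F + u) * (δ b : K)) := by
      rw [qpow_smul, mul_smul_comm, ← smul_add, smul_mul_assoc]
    simp only [h, smul_mul_assoc, smul_assoc, smul_add, Finset.smul_sum,
      Algebra.algebraMap_eq_smul_one]

/-- The subspace `{v + v^q γ^l + ∑_{b ≤ r, b ≠ l} v δ_b γ^b : v ∈ K}`. -/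
def subspaceV (r l : ℕ) (δ : ℕ → Kˣ) (γ : L) : Submodule F L where
  carrier := {x | ∃ v : K, x = algebraMap K L v + v ^ Nat.card F • γ ^ l
    + ∑ b ∈ (Finset.Icc 1 r).erase l, (v * (δ b : K)) • γ ^ b}
  zero_mem' := ⟨0, by simp [Nat.card_pos.ne']⟩
  add_mem' := by
    rintro _ _ ⟨u, rfl⟩ ⟨v, rfl⟩
    refine ⟨u + v, ?_⟩
    simp only [qpow_add, add_mul, add_smul, Finset.sum_add_distrib, map_add]
    ring
  smul_mem' := by
    rintro c _ ⟨u, rfl⟩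
    refine ⟨c • u, ?_⟩
    simp only [qpow_smul, smul_mul_assoc, smul_assoc, smul_add, Finset.smul_sum,
      Algebra.algebraMap_eq_smul_one]

/-- The set `{1, ξ, …, ξ^(q - 2)}`, where `q` is the cardinality of `F`. -/
def thetaSet (ξ : Kˣ) : Set K :=
  {θ | ∃ i < Nat.card F - 1, θ = (ξ : K) ^ i}

/-- The range of the parameter `l`: `1 ≤ l ≤ r` for `p = 1`, and
`⌊r / (p + 1)⌋ + 1 ≤ l ≤ ⌊r / p⌋`, that is, `r / (p + 1) < l ≤ r / p`, otherwise. -/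
def lRange (r p : ℕ) : Finset ℕ :=
  if p = 1 then Finset.Icc 1 r else Finset.Icc (r / (p + 1) + 1) (r / p)

/-- The union of the orbits of the spaces `subspaceU` with given `p`. -/
def codeC (r p : ℕ) (ξ : Kˣ) (γ : L) : Set (Submodule F L) :=
  ⋃ l ∈ lRange r p, ⋃ δ : ℕ → Kˣ, ⋃ θ ∈ thetaSet F ξ, cyclicOrbit (subspaceU F r p l δ θ γ)

variable (K) in
/-- The union of the orbits of the spaces `subspaceV`. -/
def codeD (r : ℕ) (γ : L) : Set (Submodule F L) :=
  ⋃ l ∈ Finset.Icc 1 r, ⋃ δ : ℕ → Kˣ, cyclicOrbit (subspaceV F r l δ γ)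

/-- The union of all these orbits. -/
def unionCode (r p₀ : ℕ) (ξ : Kˣ) (γ : L) : Set (Submodule F L) :=
  codeC F r 1 ξ γ ∪ (⋃ p ∈ Finset.Icc 2 p₀, codeC F r p ξ γ) ∪ codeD F K r γ

end Construction

/-! Every space in the code has the form `{u A(γ) + u^q B(γ)}` with `A(0) = 1`, `B(0) = 0` and `A`,
`B` of degree at most `r`. A product of two elements of such spaces is the value at `γ` of a
polynomial of degree at most `2r`, while `γ` has degree `2r + 1` over `K`, so equalities of products
in `L` are polynomial identities.

Suppose `f(u) g(t) = f(v) g(s)`, where `f`, `g` parametrize the spaces of `(A, B)` and `(A', B')`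
and `u`, `s` are nonzero. Constant coefficients give `v = mu`, `t = ms`, and the rest is `(m^q - m)
u s (s^(q-1) A B' - u^(q-1) A' B) = 0`. So either `m` lies in `F`, or `A B' = c^(q-1) A' B` with `c
= u / s` (`IsGoodPair.relation_of_mul_eq`). Such an equality arises whenever shifts of the two
spaces meet in dimension at least 2. For a single space the relation forces the shifts to be
`F`-proportional, which yields the Sidon property and the orbit length `(q^n - 1)/(q - 1)`.

It remains to see that the relation never links different parameters (`isGoodFamily_code`). Lowest
and highest degrees of `B` recover `l` and `p`, a coprimality argument recovers `δ`
(`eq_of_relation_multPoly`), and `θ` is determined because the chosen powers of `ξ` are distinct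
modulo `(q-1)`-th powers. Distance and size follow. -/

open Polynomial

/-! ### Shifts and orbits of subspaces. -/

section CyclicShift

variable {F L : Type*} [Field F] [Field L] [Algebra F L]

theorem mem_cyclicShift {α x : L} {U : Submodule F L} :
    x ∈ cyclicShift α U ↔ ∃ y ∈ U, α * y = x := by
  simp [cyclicShift]

theorem cyclicShift_cyclicShift (α β : L) (U : Submodule F L) :
    cyclicShift α (cyclicShift β U) = cyclicShift (α * β) U := by
  ext x
  simp only [mem_cyclicShift]
  constructor
  · rintro ⟨_, ⟨y, hy, rfl⟩, rfl⟩
    exact ⟨y, hy, mul_assoc _ _ _⟩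
  · rintro ⟨y, hy, rfl⟩
    exact ⟨_, ⟨y, hy, rfl⟩, (mul_assoc _ _ _).symm⟩

theorem cyclicShift_smul {c : F} (hc : c ≠ 0) (α : L) (U : Submodule F L) :
    cyclicShift (c • α) U = cyclicShift α U := by
  ext x
  simp only [mem_cyclicShift]
  constructor
  · rintro ⟨y, hy, rfl⟩
    exact ⟨c • y, U.smul_mem c hy, by simp⟩
  · rintro ⟨y, hy, rfl⟩
    exact ⟨c⁻¹ • y, U.smul_mem _ hy, by simp [hc]⟩

theorem finrank_cyclicShift {α : L} (hα : α ≠ 0) (U : Submodule F L) :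
    Module.finrank F (cyclicShift α U) = Module.finrank F U :=
  (Submodule.equivMapOfInjective (LinearMap.mulLeft F α) (mul_right_injective₀ hα) U).finrank_eq.symm

theorem one_lt_finrank_inf_cyclicShift [FiniteDimensional F L] {U V : Submodule F L} {x y : L}
    (hx : x ∈ U ⊓ V) (hy : y ∈ U ⊓ V) (hx0 : x ≠ 0) (hxy : ∀ c : F, c • x ≠ y) :
    1 < Module.finrank F (U ⊓ V : Submodule F L) := by
  have hl : LinearIndependent F ![(⟨x, hx⟩ : (U ⊓ V : Submodule F L)), ⟨y, hy⟩] := by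
    rw [LinearIndependent.pair_iff' (by simpa [Subtype.ext_iff] using hx0)]
    intro c hc
    exact hxy c (congrArg Subtype.val hc)
  simpa [Nat.lt_iff_add_one_le] using hl.fintype_card_le_finrank

theorem span_singleton_smul_eq_of_ne_zero {c : F} (hc : c ≠ 0) (x : L) :
    Submodule.span F {c • x} = Submodule.span F {x} :=
  Submodule.span_singleton_smul_eq (IsUnit.mk0 c hc) x

/-- An orbit on which only `F` stabilizes has `(|L| - 1) / (|F| - 1)` elements. -/
theorem ncard_cyclicOrbit [Finite L] {U : Submodule F L}
    (hU : ∀ α β : L, α ≠ 0 → β ≠ 0 → cyclicShift α U = cyclicShift β U →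
      ∃ c : F, c ≠ 0 ∧ α = c • β) :
    (cyclicOrbit U).ncard * (Nat.card F - 1) = Nat.card L - 1 := by
  set f : Fˣ →* Lˣ := Units.map (algebraMap F L).toMonoidHom
  have hf : Function.Injective f := Units.map_injective (algebraMap F L).injective
  have key : ∀ α β : Lˣ, cyclicShift (α : L) U = cyclicShift (β : L) U ↔ α⁻¹ * β ∈ f.range := by
    intro α β
    constructor
    · intro h
      obtain ⟨c, hc, h⟩ := hU β α β.ne_zero α.ne_zero h.symm
      refine ⟨Units.mk0 c hc, Units.ext ?_⟩
      simp [f, h, Algebra.smul_def, mul_comm]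
    · rintro ⟨c, hc⟩
      have : (β : L) = (c : F) • (α : L) := by
        rw [eq_inv_mul_iff_mul_eq] at hc
        rw [← hc]
        simp [f, Algebra.smul_def, mul_comm]
      rw [this, cyclicShift_smul c.ne_zero]
  -- The stabilizer of `U` in `Lˣ` is the image of `Fˣ`, so the orbit is in bijection with the
  -- cosets, and Lagrange's theorem counts them.
  let g : Lˣ ⧸ f.range → Submodule F L :=
    Quotient.lift (fun α : Lˣ => cyclicShift (α : L) U) fun α β h =>
      (key α β).2 (QuotientGroup.leftRel_apply.1 h)
  have hg : Function.Injective g := by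
    rintro ⟨α⟩ ⟨β⟩ h
    exact QuotientGroup.eq.2 ((key α β).1 h)
  have hr : cyclicOrbit U = Set.range g := by
    ext W
    constructor
    · rintro ⟨α, hα, rfl⟩
      exact ⟨QuotientGroup.mk (Units.mk0 α hα), rfl⟩
    · rintro ⟨⟨α⟩, rfl⟩
      exact ⟨α, α.ne_zero, rfl⟩
  rw [hr, ← Set.image_univ, Set.ncard_image_of_injective _ hg, Set.ncard_univ, ← Nat.card_units,
    ← Nat.card_units, Nat.card_congr (MonoidHom.ofInjective hf).toEquiv]
  exact (Subgroup.card_eq_card_quotient_mul_card_subgroup _).symm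

end CyclicShift

/-! ### Spaces given by pairs of polynomials, and the relation between two pairs. -/

section PolySpace

variable {F K L : Type*} [Field F] [Finite F] [Field K] [Field L]
  [Algebra F K] [Algebra K L] [Algebra F L] [IsScalarTower F K L]

/-- An element of an extension of `F` that is fixed by the Frobenius map lies in `F`. -/
theorem mem_range_algebraMap_of_pow_card_eq {x : K} (hx : x ^ Nat.card F = x) :
    x ∈ Set.range (algebraMap F K) := by
  cases nonempty_fintype F
  rw [Nat.card_eq_fintype_card] at hx
  have hs : (X ^ Fintype.card F - X : F[X]).Splits := by
    rw [splits_iff_card_roots, FiniteField.roots_X_pow_card_sub_X,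
      FiniteField.X_pow_card_sub_X_natDegree_eq F Fintype.one_lt_card]
    simp
  have h0 : (X ^ Fintype.card F - X : F[X]) ≠ 0 :=
    FiniteField.X_pow_card_sub_X_ne_zero F Fintype.one_lt_card
  -- `X^q - X` already splits over `F`, so passing to `K` adds no roots.
  have hm : x ∈ ((X ^ Fintype.card F - X : F[X]).map (algebraMap F K)).roots := by
    rw [mem_roots (map_ne_zero h0)]
    simp [hx]
  rw [hs.roots_map] at hm
  obtain ⟨a, -, ha⟩ := Multiset.mem_map.1 hm
  exact ⟨a, ha⟩

/-- If `x ^ q * y = x * y ^ q` and `x ≠ 0` then `y` is an `F`-multiple of `x`. -/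
theorem exists_smul_eq_of_mul_pow_card_eq {x y : K} (hx : x ≠ 0)
    (h : x * y ^ Nat.card F = x ^ Nat.card F * y) : ∃ c : F, y = c • x := by
  have hq : x ^ Nat.card F ≠ 0 := pow_ne_zero _ hx
  obtain ⟨c, hc⟩ := mem_range_algebraMap_of_pow_card_eq (F := F) (x := y / x) (by
    rw [div_pow, div_eq_div_iff hq hx, mul_comm, h, mul_comm])
  refine ⟨c, ?_⟩
  rw [Algebra.smul_def, hc, div_mul_cancel₀ _ hx]

/-- A nonzero `p` of smaller degree would be coprime to `P`, and a Bézout identity evaluated at `γ`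
would read `0 = 1`. This turns equations in `L` into polynomial identities. -/
theorem eq_zero_of_aeval_eq_zero_of_natDegree_lt {γ : L} {P p : K[X]} (hP : Irreducible P)
    (hγ : aeval γ P = 0) (hp : p.natDegree < P.natDegree) (h : aeval γ p = 0) : p = 0 := by
  by_contra h0
  have hc : IsCoprime P p :=
    hP.coprime_iff_not_dvd.2 fun hd => (natDegree_le_of_dvd hd h0).not_gt hp
  obtain ⟨a, b, hab⟩ := hc
  simpa [hγ, h] using congrArg (aeval γ) hab

variable (F) in
/-- The `F`-linear map `u ↦ u A(γ) + u ^ q B(γ)`. -/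
noncomputable def polyMap (γ : L) (A B : K[X]) : K →ₗ[F] L where
  toFun u := aeval γ (C u * A + C (u ^ Nat.card F) * B)
  map_add' u v := by
    simp only [qpow_add, map_add, map_mul, aeval_C]
    ring
  map_smul' c u := by
    rw [qpow_smul]
    simp only [map_add, map_mul, aeval_C, Algebra.smul_def, RingHom.id_apply,
      IsScalarTower.algebraMap_apply F K L]
    ring

theorem polyMap_apply (γ : L) (A B : K[X]) (u : K) :
    polyMap F γ A B u = aeval γ (C u * A + C (u ^ Nat.card F) * B) := rfl

variable (F) in
/-- The space `{u A(γ) + u ^ q B(γ) : u ∈ K}`. -/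
noncomputable def polySpace (γ : L) (A B : K[X]) : Submodule F L := LinearMap.range (polyMap F γ A B)

/-- The conditions on `A` and `B` used throughout. -/
structure IsGoodPair (r : ℕ) (A B : K[X]) : Prop where
  coeff_fst : A.coeff 0 = 1
  coeff_snd : B.coeff 0 = 0
  snd_ne_zero : B ≠ 0
  natDegree_fst : A.natDegree ≤ r
  natDegree_snd : B.natDegree ≤ r

namespace IsGoodPair

variable {r : ℕ} {A B A' B' : K[X]} {γ : L} {P : K[X]}

theorem fst_ne_zero (h : IsGoodPair r A B) : A ≠ 0 := by
  rintro rfl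
  simpa using h.coeff_fst

theorem natDegree_le (h : IsGoodPair r A B) (u v : K) : (C u * A + C v * B).natDegree ≤ r :=
  natDegree_add_le_of_degree_le ((natDegree_C_mul_le _ _).trans h.natDegree_fst)
    ((natDegree_C_mul_le _ _).trans h.natDegree_snd)

theorem injective_polyMap (h : IsGoodPair r A B) (hP : Irreducible P)
    (hd : P.natDegree = 2 * r + 1) (hγ : aeval γ P = 0) :
    Function.Injective (polyMap F γ A B) := by
  rw [injective_iff_map_eq_zero]
  intro u hu
  have h0 := eq_zero_of_aeval_eq_zero_of_natDegree_lt hP hγ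
    (by have := h.natDegree_le u (u ^ Nat.card F); omega) hu
  simpa [h.coeff_fst, h.coeff_snd] using congrArg (coeff · 0) h0

theorem finrank_polySpace (h : IsGoodPair r A B) (hP : Irreducible P)
    (hd : P.natDegree = 2 * r + 1) (hγ : aeval γ P = 0) :
    Module.finrank F (polySpace F γ A B) = Module.finrank F K :=
  LinearMap.finrank_range_of_inj (h.injective_polyMap hP hd hγ)

/-- An equality of cross products of elements of two spaces forces proportionality over `F`, or a
relation between the two pairs of polynomials. -/
theorem relation_of_mul_eq (h : IsGoodPair r A B) (h' : IsGoodPair r A' B') (hP : Irreducible P)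
    (hd : P.natDegree = 2 * r + 1) (hγ : aeval γ P = 0) {u v s t : K} (hu : u ≠ 0) (hs : s ≠ 0)
    (he : polyMap F γ A B u * polyMap F γ A' B' t = polyMap F γ A B v * polyMap F γ A' B' s) :
    (∃ c : F, v = c • u) ∨
      C (s ^ (Nat.card F - 1)) * (A * B') = C (u ^ (Nat.card F - 1)) * (A' * B) := by
  set q := Nat.card F with hq
  have hq0 : 0 < q := Nat.card_pos
  simp only [polyMap_apply, ← map_mul] at he
  rw [← sub_eq_zero, ← map_sub] at he
  have hz := eq_zero_of_aeval_eq_zero_of_natDegree_lt hP hγ (by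
    have h1 := h.natDegree_le u (u ^ q)
    have h2 := h'.natDegree_le t (t ^ q)
    have h3 := h.natDegree_le v (v ^ q)
    have h4 := h'.natDegree_le s (s ^ q)
    refine (natDegree_sub_le_of_le (natDegree_mul_le_of_le h1 h2)
      (natDegree_mul_le_of_le h3 h4)).trans_lt ?_
    simp only [max_self]
    omega) he
  -- The constant coefficients of the four factors are `u`, `t`, `v`, `s`.
  have hc : u * t = v * s := by
    have := congrArg (coeff · 0) hz
    simpa [mul_coeff_zero, h.coeff_fst, h.coeff_snd, h'.coeff_fst, h'.coeff_snd, sub_eq_zero]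
      using this
  obtain ⟨m, rfl⟩ : ∃ m, v = m * u := ⟨v / u, by field_simp⟩
  obtain rfl : t = m * s := by
    apply mul_left_cancel₀ hu
    rw [hc]
    ring
  by_cases hm : m ^ q = m
  · left
    obtain ⟨c, rfl⟩ := mem_range_algebraMap_of_pow_card_eq hm
    exact ⟨c, (Algebra.smul_def _ _).symm⟩
  · right
    -- With `v = mu` and `t = ms` the terms in `A A'` and `B B'` cancel, and the mixed terms share
    -- the factor `m^q - m`.
    have hk : C ((m ^ q - m) * (u * s)) *
        (C (s ^ (q - 1)) * (A * B') - C (u ^ (q - 1)) * (A' * B)) = 0 := by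
      rw [← hz, ← hq]
      obtain ⟨e, he⟩ : ∃ e, q = e + 1 := ⟨q - 1, by omega⟩
      simp only [he, Nat.add_sub_cancel, C_mul, C_pow, C_sub, mul_pow]
      ring
    rcases mul_eq_zero.1 hk with h0 | h0
    · rw [C_eq_zero] at h0
      exact absurd h0 (mul_ne_zero (sub_ne_zero.2 hm) (mul_ne_zero hu hs))
    · exact sub_eq_zero.1 h0

end IsGoodPair

/-- If shifts of two spaces meet in dimension at least two, then the polynomials are related. -/
theorem IsGoodPair.relation_of_one_lt_finrank {r : ℕ} {A B A' B' P : K[X]} {γ : L}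
    (h : IsGoodPair r A B) (h' : IsGoodPair r A' B')
    (hP : Irreducible P) (hd : P.natDegree = 2 * r + 1) (hγ : aeval γ P = 0) {α β : L}
    (hα : α ≠ 0) (hβ : β ≠ 0)
    (hI : 1 < Module.finrank F
      (cyclicShift α (polySpace F γ A B) ⊓ cyclicShift β (polySpace F γ A' B') : Submodule F L)) :
    ∃ u s : K, u ≠ 0 ∧ s ≠ 0 ∧ α * polyMap F γ A B u = β * polyMap F γ A' B' s ∧
      C (s ^ (Nat.card F - 1)) * (A * B') = C (u ^ (Nat.card F - 1)) * (A' * B) := by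
  have : Nontrivial (cyclicShift α (polySpace F γ A B) ⊓ cyclicShift β (polySpace F γ A' B') :
      Submodule F L) := Module.nontrivial_of_finrank_pos (zero_lt_one.trans hI)
  obtain ⟨⟨x, hx⟩, hx0⟩ := exists_ne (0 : (cyclicShift α (polySpace F γ A B) ⊓
    cyclicShift β (polySpace F γ A' B') : Submodule F L))
  obtain ⟨⟨y, hy⟩, hxy⟩ := exists_linearIndependent_pair_of_one_lt_finrank hI hx0
  rw [LinearIndependent.pair_iff' hx0] at hxy
  have hx0' : x ≠ 0 := fun h => hx0 (by ext; exact h)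
  obtain ⟨⟨_, ⟨u, rfl⟩, hu⟩, ⟨_, ⟨s, rfl⟩, hs⟩⟩ := And.imp mem_cyclicShift.1 mem_cyclicShift.1 hx
  obtain ⟨⟨_, ⟨v, rfl⟩, hv⟩, ⟨_, ⟨t, rfl⟩, ht⟩⟩ := And.imp mem_cyclicShift.1 mem_cyclicShift.1 hy
  have hu0 : u ≠ 0 := by rintro rfl; exact hx0' (by rw [← hu]; simp)
  have hs0 : s ≠ 0 := by rintro rfl; exact hx0' (by rw [← hs]; simp)
  refine ⟨u, s, hu0, hs0, hu.trans hs.symm, ?_⟩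
  refine (h.relation_of_mul_eq h' hP hd hγ (F := F) (v := v) (t := t) hu0 hs0 ?_).resolve_left ?_
  -- Both intersection vectors have two descriptions, `x = α f(u) = β g(s)` and `y = α f(v) = β
  -- g(t)`; the two ways of writing `x y` give the cross product equality.
  · apply mul_left_cancel₀ (mul_ne_zero hα hβ)
    calc _ = (α * polyMap F γ A B u) * (β * polyMap F γ A' B' t) := by ring
      _ = (α * polyMap F γ A B v) * (β * polyMap F γ A' B' s) := by rw [hu, ht, hv, hs, mul_comm]
      _ = _ := by ring
  · rintro ⟨c, rfl⟩
    refine hxy c (Subtype.ext ?_)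
    simp [← hu, ← hv]

/-- Two shifts of the same space that meet in dimension at least two are `F`-proportional. -/
theorem IsGoodPair.smul_eq_of_one_lt_finrank {r : ℕ} {A B P : K[X]} {γ : L}
    (h : IsGoodPair r A B)
    (hP : Irreducible P) (hd : P.natDegree = 2 * r + 1) (hγ : aeval γ P = 0) {α β : L}
    (hα : α ≠ 0) (hβ : β ≠ 0)
    (hI : 1 < Module.finrank F
      (cyclicShift α (polySpace F γ A B) ⊓ cyclicShift β (polySpace F γ A B) : Submodule F L)) :
    ∃ c : F, c ≠ 0 ∧ α = c • β := by
  obtain ⟨u, s, hu, hs, he, hr⟩ := h.relation_of_one_lt_finrank h hP hd hγ hα hβ hI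
  -- For equal pairs the nonzero factor `A B` cancels from the relation.
  have hp : s ^ (Nat.card F - 1) = u ^ (Nat.card F - 1) :=
    C_injective (mul_right_cancel₀ (mul_ne_zero h.fst_ne_zero h.snd_ne_zero) hr)
  obtain ⟨c, rfl⟩ := exists_smul_eq_of_mul_pow_card_eq (F := F) hu (y := s) (by
    have hq : Nat.card F - 1 + 1 = Nat.card F := Nat.sub_add_cancel Nat.card_pos
    rw [← hq, pow_succ, pow_succ, hp]
    ring)
  have hc : c ≠ 0 := by rintro rfl; simp at hs
  refine ⟨c, hc, ?_⟩
  have hz : polyMap F γ A B u ≠ 0 := fun h0 => hu (h.injective_polyMap hP hd hγ (by simpa using h0))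
  apply mul_right_cancel₀ hz
  rw [he, map_smul]
  simp

/-- If `ab = cd` and `d` is not an `F`-multiple of `a`, then `ca` and `cd = ab` are independent
vectors of `cU ∩ aU`, so `c` and `a` are proportional. -/
theorem IsGoodPair.isSidonSpace [FiniteDimensional F L] {r : ℕ} {A B P : K[X]} {γ : L}
    (h : IsGoodPair r A B)
    (hP : Irreducible P) (hd : P.natDegree = 2 * r + 1) (hγ : aeval γ P = 0) :
    IsSidonSpace (polySpace F γ A B) := by
  intro a ha b hb c hc d hd' ha0 hb0 hc0 hd0 he
  by_cases hdep : ∃ e : F, e • a = d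
  · obtain ⟨e, rfl⟩ := hdep
    have he0 : e ≠ 0 := by rintro rfl; simp at hd0
    have hbc : b = e • c := by
      apply mul_left_cancel₀ ha0
      rw [he]
      simp [mul_comm]
    rw [hbc, span_singleton_smul_eq_of_ne_zero he0, span_singleton_smul_eq_of_ne_zero he0, Set.pair_comm]
  · push Not at hdep
    obtain ⟨e, he0, hac⟩ := h.smul_eq_of_one_lt_finrank (F := F) hP hd hγ hc0 ha0
      (one_lt_finrank_inf_cyclicShift (x := c * a) (y := c * d)
        ⟨mem_cyclicShift.2 ⟨a, ha, rfl⟩, mem_cyclicShift.2 ⟨c, hc, mul_comm _ _⟩⟩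
        ⟨mem_cyclicShift.2 ⟨d, hd', rfl⟩, mem_cyclicShift.2 ⟨b, hb, he⟩⟩
        (mul_ne_zero hc0 ha0) (fun e h1 => hdep e (mul_left_cancel₀ hc0 (by simpa using h1))))
    subst hac
    have hbd : b = e • d := by
      apply mul_left_cancel₀ ha0
      rw [he]
      simp
    rw [hbd, span_singleton_smul_eq_of_ne_zero he0, span_singleton_smul_eq_of_ne_zero he0]

/-- A family of good pairs no two of which are related. -/
structure IsGoodFamily (F : Type*) [Field F] {K ι : Type*} [Field K] (r : ℕ)
    (A B : ι → K[X]) : Prop where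
  good : ∀ i, IsGoodPair r (A i) (B i)
  eq_of_relation : ∀ i j, ∀ c : K, c ≠ 0 →
    A i * B j = C (c ^ (Nat.card F - 1)) * (A j * B i) → i = j

/-! ### The code generated by a family of unrelated pairs. -/

namespace IsGoodFamily

variable {ι : Type*} {r : ℕ} {A B : ι → K[X]} {γ : L} {P : K[X]}

theorem eq_of_one_lt_finrank (h : IsGoodFamily F r A B) (hP : Irreducible P)
    (hd : P.natDegree = 2 * r + 1) (hγ : aeval γ P = 0) {i j : ι} {α β : L}
    (hα : α ≠ 0) (hβ : β ≠ 0)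
    (hI : 1 < Module.finrank F (cyclicShift α (polySpace F γ (A i) (B i)) ⊓
      cyclicShift β (polySpace F γ (A j) (B j)) : Submodule F L)) :
    i = j := by
  obtain ⟨u, s, hu, hs, -, hr⟩ := (h.good i).relation_of_one_lt_finrank (h.good j) hP hd hγ hα hβ hI
  refine h.eq_of_relation i j (u / s) (div_ne_zero hu hs) ?_
  have hs' : C (s ^ (Nat.card F - 1)) ≠ 0 := by simpa using pow_ne_zero _ hs
  apply mul_left_cancel₀ hs'
  rw [hr, ← mul_assoc (C _) (C _), ← C_mul, div_pow, mul_div_cancel₀ _ (pow_ne_zero _ hs)]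

theorem isCyclicCDC [FiniteDimensional F L] (h : IsGoodFamily F r A B) [Nonempty ι]
    (hP : Irreducible P) (hd : P.natDegree = 2 * r + 1) (hγ : aeval γ P = 0)
    (hk : 2 ≤ Module.finrank F K) :
    IsCyclicCDC (Nat.card F) (Module.finrank F L) (2 * (Module.finrank F K : ℤ) - 2)
      (Module.finrank F K) (⋃ i, cyclicOrbit (polySpace F γ (A i) (B i))) := by
  have hdim : ∀ i, ∀ α : L, α ≠ 0 →
      Module.finrank F (cyclicShift α (polySpace F γ (A i) (B i))) = Module.finrank F K :=
    fun i α hα => (finrank_cyclicShift hα _).trans ((h.good i).finrank_polySpace hP hd hγ)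
  have hsub : ∀ i j, ∀ α β : L, α ≠ 0 → β ≠ 0 →
      cyclicShift α (polySpace F γ (A i) (B i)) ≠ cyclicShift β (polySpace F γ (A j) (B j)) →
      Module.finrank F (cyclicShift α (polySpace F γ (A i) (B i)) ⊓
        cyclicShift β (polySpace F γ (A j) (B j)) : Submodule F L) ≤ 1 := by
    intro i j α β hα hβ hne
    by_contra! hI
    obtain rfl := h.eq_of_one_lt_finrank hP hd hγ hα hβ hI
    obtain ⟨c, hc, rfl⟩ := (h.good i).smul_eq_of_one_lt_finrank hP hd hγ hα hβ hI
    exact hne (cyclicShift_smul hc _ _)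
  refine ⟨rfl, rfl, ?_, ?_, ⟨?_, ?_⟩, ?_⟩
  · obtain ⟨i⟩ := ‹Nonempty ι›
    exact ⟨_, Set.mem_iUnion.2 ⟨i, 1, one_ne_zero, rfl⟩⟩
  · intro U hU
    obtain ⟨i, α, hα, rfl⟩ := Set.mem_iUnion.1 hU
    exact hdim i α hα
  · obtain ⟨i⟩ := ‹Nonempty ι›
    have hf := (h.good i).finrank_polySpace (F := F) hP hd hγ
    have : Nontrivial (polySpace F γ (A i) (B i)) :=
      Module.nontrivial_of_finrank_pos (R := F) (by omega)
    obtain ⟨⟨x, hx⟩, hx0⟩ := exists_ne (0 : polySpace F γ (A i) (B i))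
    obtain ⟨⟨y, hy⟩, hxy⟩ := exists_linearIndependent_pair_of_one_lt_finrank
      (R := F) (by omega) hx0
    rw [LinearIndependent.pair_iff' hx0] at hxy
    have hx0' : x ≠ 0 := fun h => hx0 (by ext; exact h)
    have hxy' : ∀ c : F, c • x ≠ y := fun c hc => hxy c (Subtype.ext hc)
    have hy0 : y ≠ 0 := fun h => hxy' 0 (by simp [h])
    -- For independent `x`, `y` in `U`, the shifts `xU` and `yU` differ but share `xy`, so they
    -- attain the distance `2k - 2`.
    have hne : cyclicShift x (polySpace F γ (A i) (B i)) ≠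
        cyclicShift y (polySpace F γ (A i) (B i)) := by
      intro he
      obtain ⟨c, hc, hcy⟩ := (h.good i).smul_eq_of_one_lt_finrank hP hd hγ hy0 hx0'
        (by rw [← he, inf_idem, hdim i x hx0']; omega)
      exact hxy' c hcy.symm
    refine ⟨_, Set.mem_iUnion.2 ⟨i, x, hx0', rfl⟩, _, Set.mem_iUnion.2 ⟨i, y, hy0, rfl⟩, hne, ?_⟩
    have h1 := hsub i i x y hx0' hy0 hne
    have h2 : 0 < Module.finrank F (cyclicShift x (polySpace F γ (A i) (B i)) ⊓
        cyclicShift y (polySpace F γ (A i) (B i)) : Submodule F L) := by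
      rw [Module.finrank_pos_iff]
      refine ⟨⟨⟨x * y, mem_cyclicShift.2 ⟨y, hy, rfl⟩, mem_cyclicShift.2 ⟨x, hx, mul_comm _ _⟩⟩, 0,
        ?_⟩⟩
      simpa [Subtype.ext_iff] using ⟨hx0', hy0⟩
    rw [subspaceDist, hdim i x hx0', hdim i y hy0]
    omega
  · rintro m ⟨U, hU, V, hV, hne, rfl⟩
    obtain ⟨i, α, hα, rfl⟩ := Set.mem_iUnion.1 hU
    obtain ⟨j, β, hβ, rfl⟩ := Set.mem_iUnion.1 hV
    have := hsub i j α β hα hβ hne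
    rw [subspaceDist, hdim i α hα, hdim j β hβ]
    omega
  · intro U hU α hα
    obtain ⟨i, β, hβ, rfl⟩ := Set.mem_iUnion.1 hU
    exact Set.mem_iUnion.2 ⟨i, α * β, mul_ne_zero hα hβ, cyclicShift_cyclicShift α β _⟩

/-- A space common to two orbits, or reached by two shifts, meets itself in dimension `k ≥ 2`; so
orbits of different indices are disjoint and only `F` stabilizes each space. -/
theorem ncard_iUnion [Finite L] [Finite ι] (h : IsGoodFamily F r A B)
    (hP : Irreducible P) (hd : P.natDegree = 2 * r + 1) (hγ : aeval γ P = 0)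
    (hk : 2 ≤ Module.finrank F K) :
    (⋃ i, cyclicOrbit (polySpace F γ (A i) (B i))).ncard * (Nat.card F - 1) =
      Nat.card ι * (Nat.card L - 1) := by
  cases nonempty_fintype ι
  have hfin : Finite (Submodule F L) := Finite.of_injective _ SetLike.coe_injective
  have hdim : ∀ i, ∀ α : L, α ≠ 0 →
      Module.finrank F (cyclicShift α (polySpace F γ (A i) (B i))) = Module.finrank F K :=
    fun i α hα => (finrank_cyclicShift hα _).trans ((h.good i).finrank_polySpace hP hd hγ)
  have hdisj : Pairwise (Function.onFun Disjoint
      fun i => cyclicOrbit (polySpace F γ (A i) (B i))) := by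
    intro i j hij
    rw [Function.onFun, Set.disjoint_left]
    rintro _ ⟨α, hα, rfl⟩ ⟨β, hβ, he⟩
    refine hij (h.eq_of_one_lt_finrank hP hd hγ hα hβ ?_)
    rw [← he, inf_idem, hdim i α hα]
    omega
  rw [Set.ncard_iUnion_of_finite (fun i => Set.toFinite _) hdisj, finsum_eq_sum_of_fintype,
    Finset.sum_mul, Finset.sum_congr rfl (g := fun _ => Nat.card L - 1)]
  · simp
  · intro i _
    apply ncard_cyclicOrbit
    intro α β hα hβ he
    refine (h.good i).smul_eq_of_one_lt_finrank hP hd hγ hα hβ ?_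
    rw [← he, inf_idem, hdim i α hα]
    omega

end IsGoodFamily

end PolySpace

/-! ### The relation for the concrete polynomials. -/

section Relations

variable {K : Type*} [Field K]

/-- The polynomial `1 + ∑_{b ∈ S} δ_b X ^ b`. -/
noncomputable def onePoly (S : Finset ℕ) (δ : ℕ → Kˣ) : K[X] :=
  1 + ∑ b ∈ S, C (δ b : K) * X ^ b

theorem coeff_onePoly_zero {S : Finset ℕ} (hS : 0 ∉ S) (δ : ℕ → Kˣ) :
    (onePoly S δ).coeff 0 = 1 := by
  simp only [onePoly, coeff_add, coeff_one_zero, finsetSum_coeff, coeff_C_mul_X_pow]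
  rw [Finset.sum_ite_eq S 0, if_neg hS, add_zero]

theorem coeff_onePoly {S : Finset ℕ} {n : ℕ} (hn : n ≠ 0) (δ : ℕ → Kˣ) :
    (onePoly S δ).coeff n = if n ∈ S then (δ n : K) else 0 := by
  simp only [onePoly, coeff_add, coeff_one, if_neg hn, finsetSum_coeff, coeff_C_mul_X_pow, zero_add]
  rw [Finset.sum_ite_eq S n]

theorem onePoly_ne_zero {S : Finset ℕ} (hS : 0 ∉ S) (δ : ℕ → Kˣ) : onePoly S δ ≠ 0 := by
  intro h
  simpa [h] using coeff_onePoly_zero hS δ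

theorem onePoly_congr {S : Finset ℕ} {δ ε : ℕ → Kˣ} (h : ∀ b ∈ S, δ b = ε b) :
    onePoly S δ = onePoly S ε := by
  rw [onePoly, onePoly, Finset.sum_congr rfl fun b hb => by rw [h b hb]]

theorem eqOn_of_onePoly_eq {S : Finset ℕ} (hS : 0 ∉ S) {δ ε : ℕ → Kˣ}
    (h : onePoly S δ = onePoly S ε) : ∀ b ∈ S, δ b = ε b := by
  intro b hb
  have hb0 : b ≠ 0 := by rintro rfl; exact hS hb
  have := congrArg (coeff · b) h
  exact Units.ext (by simpa [coeff_onePoly hb0, hb] using this)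

theorem natDegree_onePoly_le {S : Finset ℕ} {r : ℕ} (hS : ∀ b ∈ S, b ≤ r) (δ : ℕ → Kˣ) :
    (onePoly S δ).natDegree ≤ r := by
  rw [natDegree_le_iff_coeff_eq_zero]
  intro n hn
  rw [coeff_onePoly (by omega), if_neg fun h => (hS n h).not_gt hn]

theorem natDegree_onePoly {S : Finset ℕ} {r : ℕ} (hr : r ≠ 0) (hS : ∀ b ∈ S, b ≤ r) (hrS : r ∈ S)
    (δ : ℕ → Kˣ) : (onePoly S δ).natDegree = r :=
  natDegree_eq_of_le_of_coeff_ne_zero (natDegree_onePoly_le hS δ)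
    (by simp [coeff_onePoly hr, hrS])

/-- The polynomial `∑_{a = 1}^p δ_{a l} X ^ (a l)`. -/
noncomputable def multPoly (p l : ℕ) (δ : ℕ → Kˣ) : K[X] :=
  expand K l (onePoly (Finset.Icc 1 p) (fun a => δ (a * l)) - 1)

theorem multPoly_eq_sum (p l : ℕ) (δ : ℕ → Kˣ) :
    multPoly p l δ = ∑ a ∈ Finset.Icc 1 p, C (δ (a * l) : K) * X ^ (a * l) := by
  simp only [multPoly, onePoly, add_sub_cancel_left, map_sum, map_mul, expand_C, map_pow, expand_X,
    ← pow_mul, mul_comm l]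

theorem coeff_multPoly_of_lt {p l n : ℕ} (hn : n < l) (δ : ℕ → Kˣ) :
    (multPoly p l δ).coeff n = 0 := by
  rw [multPoly, coeff_expand (by omega)]
  split_ifs with h
  · obtain rfl := Nat.eq_zero_of_dvd_of_lt h hn
    simp [coeff_onePoly_zero]
  · rfl

theorem coeff_multPoly_self {p l : ℕ} (hp : 1 ≤ p) (hl : 1 ≤ l) (δ : ℕ → Kˣ) :
    (multPoly p l δ).coeff l = δ l := by
  rw [multPoly, coeff_expand hl, if_pos dvd_rfl, Nat.div_self hl, coeff_sub,
    coeff_onePoly one_ne_zero, if_pos (by simpa using hp)]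
  simp [coeff_one]

theorem multPoly_ne_zero {p l : ℕ} (hp : 1 ≤ p) (hl : 1 ≤ l) (δ : ℕ → Kˣ) :
    multPoly p l δ ≠ 0 := by
  intro h
  exact (δ l).ne_zero (by simpa [h] using (coeff_multPoly_self hp hl δ).symm)

theorem natTrailingDegree_multPoly {p l : ℕ} (hp : 1 ≤ p) (hl : 1 ≤ l) (δ : ℕ → Kˣ) :
    (multPoly p l δ).natTrailingDegree = l :=
  le_antisymm (natTrailingDegree_le_of_ne_zero (by simp [coeff_multPoly_self hp hl]))
    (le_natTrailingDegree (multPoly_ne_zero hp hl δ) fun _ h => coeff_multPoly_of_lt h δ)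

theorem natDegree_multPoly {p : ℕ} (hp : 1 ≤ p) (l : ℕ) (δ : ℕ → Kˣ) :
    (multPoly p l δ).natDegree = p * l := by
  rw [multPoly, natDegree_expand, ← C_1, natDegree_sub_C, natDegree_onePoly (r := p) (by omega) (by simp)]
  simpa using hp

theorem multPoly_congr {p l r : ℕ} (hl : 1 ≤ l) (hr : p * l ≤ r) {δ ε : ℕ → Kˣ}
    (h : ∀ b ∈ Finset.Icc 1 r, δ b = ε b) : multPoly p l δ = multPoly p l ε := by
  rw [multPoly_eq_sum, multPoly_eq_sum]
  refine Finset.sum_congr rfl fun a ha => ?_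
  rw [Finset.mem_Icc] at ha
  rw [h _ (Finset.mem_Icc.2 ⟨Nat.mul_pos ha.1 hl, (Nat.mul_le_mul_right l ha.2).trans hr⟩)]

/-- When `p = r / l`, the right side is the polynomial `G` for which `multPoly p l δ` is the
expansion of `G - 1`. Contraction thus reduces the relation to one between `G` and `G'` alone. -/
theorem contract_onePoly {r l : ℕ} (hl : 1 ≤ l) (δ : ℕ → Kˣ) :
    contract l (onePoly (Finset.Icc 1 r) δ) =
      onePoly (Finset.Icc 1 (r / l)) fun a => δ (a * l) := by
  ext n
  rw [coeff_contract (by omega)]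
  rcases eq_or_ne n 0 with rfl | hn
  · simp [coeff_onePoly_zero]
  · have hnl : n * l ≠ 0 := mul_ne_zero hn (by omega)
    rw [coeff_onePoly hnl, coeff_onePoly hn]
    simp [Nat.le_div_iff_mul_le hl, Nat.one_le_iff_ne_zero, hn, hnl]

/-- Trailing degrees add under multiplication, and those of `A` and `A'` are zero. -/
theorem natTrailingDegree_eq_of_relation {A A' B B' : K[X]} (hA : A.coeff 0 = 1)
    (hA' : A'.coeff 0 = 1) (hB : B ≠ 0) (hB' : B' ≠ 0) {μ : K} (hμ : μ ≠ 0)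
    (h : A * B' = C μ * (A' * B)) : B.natTrailingDegree = B'.natTrailingDegree := by
  have h0 : ∀ {f : K[X]}, f.coeff 0 = 1 → f ≠ 0 ∧ f.natTrailingDegree = 0 := by
    intro f hf
    have hne : f.coeff 0 ≠ 0 := by simp [hf]
    exact ⟨by rintro rfl; simp at hf, Nat.le_zero.1 (natTrailingDegree_le_of_ne_zero hne)⟩
  have hμ' : C μ ≠ 0 := C_ne_zero.2 hμ
  have := congrArg natTrailingDegree h
  rw [natTrailingDegree_mul (h0 hA).1 hB', natTrailingDegree_mul hμ' (mul_ne_zero (h0 hA').1 hB),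
    natTrailingDegree_mul (h0 hA').1 hB, natTrailingDegree_C, (h0 hA).2, (h0 hA').2] at this
  omega

theorem eq_one_of_eq_C_mul {A A' : K[X]} (hA : A.coeff 0 = 1) (hA' : A'.coeff 0 = 1) {μ : K}
    (h : A = C μ * A') : μ = 1 ∧ A = A' := by
  have h1 : μ = 1 := by
    have := congrArg (coeff · 0) h
    simpa [hA, hA'] using this.symm
  exact ⟨h1, by rw [h, h1]; simp⟩

/-- Polynomials with constant coefficient `1` that satisfy `G (G' - 1) = μ G' (G - 1)` coincide. -/
theorem eq_of_mul_sub_one_eq {G G' : K[X]} (hG : G.coeff 0 = 1) (hG' : G'.coeff 0 = 1) {μ : K}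
    (hμ : μ ≠ 0) (h : G * (G' - 1) = C μ * (G' * (G - 1))) : G = G' := by
  -- Coprimality makes `G` and `G'` divide each other, so they differ by a constant, which the
  -- constant coefficients show to be `1`.
  have hc : ∀ H : K[X], IsCoprime H (H - 1) := fun H => ⟨1, -1, by ring⟩
  have hu : IsUnit (C μ) := isUnit_C.2 hμ.isUnit
  have h1 : G ∣ G' := (hc G).dvd_of_dvd_mul_right
    (hu.dvd_mul_left.1 (h ▸ dvd_mul_right _ _))
  have h2 : G' ∣ G := (hc G').dvd_of_dvd_mul_right
    (h ▸ (dvd_mul_right _ _).mul_left _)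
  obtain ⟨w, hw⟩ := associated_of_dvd_dvd h2 h1
  obtain ⟨c, -, hc⟩ := isUnit_iff.1 w.isUnit
  exact (eq_one_of_eq_C_mul hG hG' (μ := c) (by rw [← hw, ← hc, mul_comm])).2

/-- Trailing degrees give `l`, degrees give `p`. For `p = 1` both `B`'s are multiples of `X^l`,
which cancels. For `p = r / l` all multiples of `l` up to `r` occur in `B`, and contraction by `l`
determines their coefficients first. -/
theorem eq_of_relation_multPoly {r p l p' l' : ℕ} (hp : 1 ≤ p) (hl : 1 ≤ l) (hpl : p * l ≤ r)
    (hr : p = 1 ∨ p = r / l) (hp' : 1 ≤ p') (hl' : 1 ≤ l') {δ δ' : ℕ → Kˣ} {μ : K} (hμ : μ ≠ 0)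
    (h : onePoly (Finset.Icc 1 r) δ * multPoly p' l' δ' =
      C μ * (onePoly (Finset.Icc 1 r) δ' * multPoly p l δ)) :
    p = p' ∧ l = l' ∧ (∀ b ∈ Finset.Icc 1 r, δ b = δ' b) ∧ μ = 1 := by
  have h0 : ∀ m, 0 ∉ Finset.Icc 1 m := by simp
  have hr0 : 1 ≤ r := (Nat.mul_pos hp hl).trans_le hpl
  have hA := coeff_onePoly_zero (h0 r) δ
  have hA' := coeff_onePoly_zero (h0 r) δ'
  have hB := multPoly_ne_zero hp hl δ
  have hB' := multPoly_ne_zero hp' hl' δ'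
  obtain rfl : l = l' := by
    simpa [natTrailingDegree_multPoly, *] using
      natTrailingDegree_eq_of_relation hA hA' hB hB' hμ h
  have hdeg : ∀ ε : ℕ → Kˣ, (onePoly (Finset.Icc 1 r) ε).natDegree = r :=
    natDegree_onePoly (by omega) (by simp) (by simpa using hr0)
  obtain rfl : p = p' := by
    have := congrArg natDegree h
    rw [natDegree_mul (onePoly_ne_zero (h0 r) δ) hB', natDegree_C_mul hμ,
      natDegree_mul (onePoly_ne_zero (h0 r) δ') hB, hdeg, hdeg, natDegree_multPoly hp,
      natDegree_multPoly hp'] at this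
    exact (Nat.eq_of_mul_eq_mul_right hl (by omega)).symm
  have key : onePoly (Finset.Icc 1 r) δ = onePoly (Finset.Icc 1 r) δ' := by
    rcases hr with rfl | rfl
    · have hX : (X : K[X]) ^ l ≠ 0 := pow_ne_zero _ X_ne_zero
      have hδ : C (δ' l : K) ≠ 0 := by simp
      refine (eq_one_of_eq_C_mul hA hA' (μ := μ * δ l * (δ' l : K)⁻¹) ?_).2
      apply mul_right_cancel₀ (mul_ne_zero hδ hX)
      simp only [multPoly_eq_sum, Finset.Icc_self, Finset.sum_singleton, one_mul] at h
      have h1 : C (δ' l : K)⁻¹ * C (δ' l : K) = 1 := by rw [← C_mul]; simp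
      rw [h, C_mul, C_mul]
      linear_combination (-C μ * C (δ l : K) * X ^ l * onePoly (Finset.Icc 1 r) δ') * h1
    · have hE := congrArg (contract l) h
      rw [← mul_assoc, multPoly, multPoly, contract_mul_expand (by omega),
        contract_mul_expand (by omega), contract_onePoly hl,
        ← expand_C (R := K) l μ, mul_comm (expand K l (C μ)), contract_mul_expand (by omega),
        contract_onePoly hl, mul_comm _ (C μ), mul_assoc] at hE
      have hG := eq_of_mul_sub_one_eq (coeff_onePoly_zero (h0 _) _) (coeff_onePoly_zero (h0 _) _)
        hμ hE
      -- The coefficients at multiples of `l` agree, so the `B`'s cancel and the other coefficients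
      -- follow.
      have hD : multPoly (r / l) l δ = multPoly (r / l) l δ' := by rw [multPoly, multPoly, hG]
      rw [← hD, ← mul_assoc] at h
      exact (eq_one_of_eq_C_mul hA hA' (mul_right_cancel₀ hB h)).2
  have hδ := eqOn_of_onePoly_eq (h0 r) key
  refine ⟨rfl, rfl, hδ, ?_⟩
  rw [multPoly_congr hl hpl hδ, ← mul_assoc] at h
  exact (eq_one_of_eq_C_mul hA hA' (mul_right_cancel₀ hB' h)).1

theorem zero_notMem_Icc_erase (r l : ℕ) : 0 ∉ (Finset.Icc 1 r).erase l := by simp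

/-- Degrees force `l = l'` and `p = 1`; after cancelling `X^l` the two `A`'s are proportional, but
only the first has a term in `X^l`. -/
theorem not_relation_multPoly_X_pow {r p l l' : ℕ} (hp : 1 ≤ p) (hl : 1 ≤ l) (hpl : p * l ≤ r)
    {δ δ' : ℕ → Kˣ} {μ : K} (hμ : μ ≠ 0)
    (h : onePoly (Finset.Icc 1 r) δ * X ^ l' =
      C μ * (onePoly ((Finset.Icc 1 r).erase l') δ' * multPoly p l δ)) : False := by
  have hr0 : 1 ≤ r := (Nat.mul_pos hp hl).trans_le hpl
  have h0 : 0 ∉ Finset.Icc 1 r := by simp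
  have h0' := zero_notMem_Icc_erase r l'
  have hB := multPoly_ne_zero hp hl δ
  have hX : (X : K[X]) ^ l' ≠ 0 := pow_ne_zero _ X_ne_zero
  obtain rfl : l = l' := by
    simpa [natTrailingDegree_multPoly, *] using natTrailingDegree_eq_of_relation
      (coeff_onePoly_zero h0 δ) (coeff_onePoly_zero h0' δ') hB hX hμ h
  have hlr : l ≤ r := le_trans (Nat.le_mul_of_pos_left l hp) hpl
  obtain rfl : p = 1 := by
    -- For `l = r` the bound `p * l ≤ r` gives `p = 1`. For `l < r` the index `r` survives the
    -- erasure, so both `A`'s have degree `r` and degrees can be compared.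
    rcases hlr.eq_or_lt with rfl | hlr
    · have : p * l ≤ 1 * l := by simpa using hpl
      have := Nat.le_of_mul_le_mul_right this hl
      omega
    · have := congrArg natDegree h
      rw [natDegree_mul (onePoly_ne_zero h0 δ) hX, natDegree_C_mul hμ,
        natDegree_mul (onePoly_ne_zero h0' δ') hB,
        natDegree_onePoly (r := r) (by omega) (by simp) (by simpa using hr0),
        natDegree_onePoly (S := (Finset.Icc 1 r).erase l) (r := r) (by omega)
          (fun b hb => (Finset.mem_Icc.1 (Finset.mem_of_mem_erase hb)).2)
          (by simp; omega), natDegree_multPoly hp, natDegree_X_pow] at this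
      exact Nat.eq_of_mul_eq_mul_right hl (by omega)
  simp only [multPoly_eq_sum, Finset.Icc_self, Finset.sum_singleton, one_mul] at h
  rw [mul_left_comm (onePoly _ _) (C _), ← mul_assoc, ← mul_assoc, ← C_mul] at h
  have := congrArg (coeff · l) (mul_right_cancel₀ hX h)
  rw [coeff_C_mul, coeff_onePoly (by omega), coeff_onePoly (by omega), 
    if_pos (Finset.mem_Icc.2 ⟨hl, hlr⟩), if_neg (Finset.notMem_erase _ _), mul_zero] at this
  exact (δ l).ne_zero this

theorem eq_of_relation_X_pow {r l l' : ℕ} {δ δ' : ℕ → Kˣ} {μ : K} (hμ : μ ≠ 0)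
    (h : onePoly ((Finset.Icc 1 r).erase l) δ * X ^ l' =
      C μ * (onePoly ((Finset.Icc 1 r).erase l') δ' * X ^ l)) :
    l = l' ∧ ∀ b ∈ (Finset.Icc 1 r).erase l, δ b = δ' b := by
  have hX : ∀ l, (X : K[X]) ^ l ≠ 0 := fun l => pow_ne_zero _ X_ne_zero
  have hA := coeff_onePoly_zero (zero_notMem_Icc_erase r l) δ
  have hA' := coeff_onePoly_zero (zero_notMem_Icc_erase r l') δ'
  obtain rfl : l = l' := by
    simpa using natTrailingDegree_eq_of_relation hA hA' (hX l) (hX l') hμ h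
  rw [← mul_assoc] at h
  exact ⟨rfl, eqOn_of_onePoly_eq (zero_notMem_Icc_erase r l)
    (eq_one_of_eq_C_mul hA hA' (mul_right_cancel₀ (hX l) h)).2⟩

/-- The powers `ξ ^ i`, `i < m`, of a generator of `Kˣ` are distinct modulo `m`-th powers, when
`m` divides the order of `Kˣ`. -/
theorem eq_of_pow_mul_pow_eq [Finite K] {ξ : Kˣ} (hξ : ∀ x : Kˣ, x ∈ Subgroup.zpowers ξ) {m : ℕ}
    (hm : m ∣ Nat.card Kˣ) {i j : ℕ} (hi : i < m) (hj : j < m) {c : K} (hc : c ≠ 0)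
    (h : c ^ m * (ξ : K) ^ i = (ξ : K) ^ j) : i = j := by
  obtain ⟨e, he⟩ := (mem_powers_iff_mem_zpowers (x := ξ)).2 (hξ (Units.mk0 c hc))
  have hc' : c = (ξ : K) ^ e := by
    rw [← Units.val_pow_eq_pow_val, show ξ ^ e = Units.mk0 c hc from he, Units.val_mk0]
  rw [hc', ← pow_mul, ← pow_add, ← Units.val_pow_eq_pow_val, ← Units.val_pow_eq_pow_val,
    Units.val_inj, pow_eq_pow_iff_modEq, orderOf_eq_card_of_forall_mem_zpowers hξ] at h
  -- With `c = ξ^e` the exponents `m e + i` and `j` agree modulo the order of `Kˣ`, hence modulo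
  -- `m`.
  have := h.of_dvd hm
  rw [Nat.ModEq, Nat.mul_add_mod_self_right, Nat.mod_eq_of_lt hi, Nat.mod_eq_of_lt hj] at this
  exact this

end Relations

/-! ### The spaces of the theorem as a family of pairs, and the count of parameters. -/

section Family

variable {F K L : Type*} [Field F] [Finite F] [Field K] [Field L]
  [Algebra F K] [Algebra K L] [Algebra F L] [IsScalarTower F K L]

theorem aeval_onePoly (S : Finset ℕ) (δ : ℕ → Kˣ) (γ : L) (u : K) :
    algebraMap K L u * aeval γ (onePoly S δ) =
      algebraMap K L u + ∑ b ∈ S, (u * (δ b : K)) • γ ^ b := by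
  simp [onePoly, mul_add, Finset.mul_sum, Algebra.smul_def, mul_assoc]

/-- The summands `u δ_b γ^b` at the multiples of `l` and at the other indices recombine into one sum
over `1, …, r`, leaving only `θ u^q` on the multiples. -/
theorem subspaceU_eq_polySpace {r p l : ℕ} (hl : 1 ≤ l) (hpl : p * l ≤ r) (δ : ℕ → Kˣ) (θ : K)
    (γ : L) :
    subspaceU F r p l δ θ γ =
      polySpace F γ (onePoly (Finset.Icc 1 r) δ) (C θ * multPoly p l δ) := by
  have hsub : ((Finset.Icc 1 p).image fun a => a * l) ⊆ Finset.Icc 1 r := by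
    intro b hb
    obtain ⟨a, ha, rfl⟩ := Finset.mem_image.1 hb
    rw [Finset.mem_Icc] at ha ⊢
    exact ⟨Nat.mul_pos ha.1 hl, (Nat.mul_le_mul_right l ha.2).trans hpl⟩
  have hsum : ∀ u : K, ∑ b ∈ Finset.Icc 1 r, (u * (δ b : K)) • γ ^ b =
      ∑ b ∈ nonMultiples r p l, (u * (δ b : K)) • γ ^ b +
        ∑ a ∈ Finset.Icc 1 p, (u * (δ (a * l) : K)) • γ ^ (a * l) := by
    intro u
    rw [nonMultiples, ← Finset.sum_sdiff hsub, Finset.sum_image]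
    intro a _ b _ h
    exact Nat.eq_of_mul_eq_mul_right hl h
  have key : ∀ u : K, algebraMap K L u
      + ∑ a ∈ Finset.Icc 1 p, ((θ * u ^ Nat.card F + u) * (δ (a * l) : K)) • γ ^ (a * l)
      + ∑ b ∈ nonMultiples r p l, (u * (δ b : K)) • γ ^ b =
      polyMap F γ (onePoly (Finset.Icc 1 r) δ) (C θ * multPoly p l δ) u := by
    intro u
    rw [polyMap_apply, map_add, map_mul, aeval_C, aeval_onePoly, hsum]
    simp only [add_mul, map_add, Finset.sum_add_distrib, multPoly_eq_sum, map_mul, map_sum, aeval_C,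
      map_pow, aeval_X, Algebra.smul_def, Finset.mul_sum]
    have : ∀ a, (algebraMap K L) u ^ Nat.card F * ((algebraMap K L) θ *
        ((algebraMap K L) (δ (a * l)) * γ ^ (a * l))) = (algebraMap K L) θ *
        (algebraMap K L) u ^ Nat.card F * (algebraMap K L) (δ (a * l)) * γ ^ (a * l) := by
      intro a
      ring
    simp only [this]
    ring
  ext x
  constructor
  · rintro ⟨u, rfl⟩
    exact ⟨u, (key u).symm⟩
  · rintro ⟨u, rfl⟩
    exact ⟨u, (key u).symm⟩

theorem subspaceV_eq_polySpace (r l : ℕ) (δ : ℕ → Kˣ) (γ : L) :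
    subspaceV F r l δ γ = polySpace F γ (onePoly ((Finset.Icc 1 r).erase l) δ) (X ^ l) := by
  have key : ∀ v : K, algebraMap K L v + v ^ Nat.card F • γ ^ l
      + ∑ b ∈ (Finset.Icc 1 r).erase l, (v * (δ b : K)) • γ ^ b =
      polyMap F γ (onePoly ((Finset.Icc 1 r).erase l) δ) (X ^ l) v := by
    intro v
    rw [polyMap_apply, map_add, map_mul, aeval_C, aeval_onePoly]
    simp only [map_mul, aeval_C, map_pow, aeval_X, Algebra.smul_def]
    ring
  ext x
  constructor
  · rintro ⟨u, rfl⟩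
    exact ⟨u, (key u).symm⟩
  · rintro ⟨u, rfl⟩
    exact ⟨u, (key u).symm⟩

theorem isGoodPair_multPoly {r p l : ℕ} (hp : 1 ≤ p) (hl : 1 ≤ l) (hpl : p * l ≤ r) (δ : ℕ → Kˣ)
    {θ : K} (hθ : θ ≠ 0) :
    IsGoodPair r (onePoly (Finset.Icc 1 r) δ) (C θ * multPoly p l δ) where
  coeff_fst := coeff_onePoly_zero (by simp) δ
  coeff_snd := by rw [coeff_C_mul, coeff_multPoly_of_lt hl, mul_zero]
  snd_ne_zero := mul_ne_zero (C_ne_zero.2 hθ) (multPoly_ne_zero hp hl δ)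
  natDegree_fst := natDegree_onePoly_le (by simp) δ
  natDegree_snd := by rwa [natDegree_C_mul hθ, natDegree_multPoly hp]

theorem isGoodPair_X_pow {r l : ℕ} (hl : l ∈ Finset.Icc 1 r) (δ : ℕ → Kˣ) :
    IsGoodPair r (onePoly ((Finset.Icc 1 r).erase l) δ) (X ^ l) where
  coeff_fst := coeff_onePoly_zero (zero_notMem_Icc_erase r l) δ
  coeff_snd := by
    rw [Finset.mem_Icc] at hl
    rw [coeff_X_pow, if_neg (by omega)]
  snd_ne_zero := pow_ne_zero _ X_ne_zero
  natDegree_fst := natDegree_onePoly_le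
    (fun _ hb => (Finset.mem_Icc.1 (Finset.mem_of_mem_erase hb)).2) δ
  natDegree_snd := by rw [natDegree_X_pow]; exact (Finset.mem_Icc.1 hl).2

/-- For `p ≥ 2`, the condition `r / (p + 1) < l ≤ r / p` says exactly that `p = r / l`. This is the
dichotomy that recovering `δ` needs. -/
theorem lRange_spec {r p l : ℕ} (hp : 1 ≤ p) (hl : l ∈ lRange r p) :
    1 ≤ l ∧ p * l ≤ r ∧ (p = 1 ∨ p = r / l) := by
  unfold lRange at hl
  split_ifs at hl with h
  · subst h
    simpa using hl
  · rw [Finset.mem_Icc, Nat.succ_le_iff, Nat.div_lt_iff_lt_mul (by omega),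
      Nat.le_div_iff_mul_le hp] at hl
    have hl0 : 1 ≤ l := by
      rcases Nat.eq_zero_or_pos l with rfl | h0
      · simp at hl
      · exact h0
    refine ⟨hl0, by rw [mul_comm]; exact hl.2, Or.inr ?_⟩
    refine (Nat.div_eq_of_lt_le ?_ ?_).symm
    · rw [mul_comm]; exact hl.2
    · rw [mul_comm]; exact hl.1

theorem card_lRange_one (r : ℕ) : (lRange r 1).card = r := by simp [lRange]

theorem card_lRange {r p : ℕ} (hp : 2 ≤ p) : (lRange r p).card = r / p - r / (p + 1) := by
  rw [lRange, if_neg (by omega), Nat.card_Icc]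
  omega

/-- The pairs `(p, l)` that index the spaces `subspaceU`. -/
def pairRange (r p₀ : ℕ) : Finset (Σ _ : ℕ, ℕ) := (Finset.Icc 1 p₀).sigma (lRange r)

theorem pairRange_spec {r p₀ : ℕ} (x : pairRange r p₀) :
    1 ≤ x.1.1 ∧ 1 ≤ x.1.2 ∧ x.1.1 * x.1.2 ≤ r ∧ (x.1.1 = 1 ∨ x.1.1 = r / x.1.2) := by
  obtain ⟨h1, h2⟩ := Finset.mem_sigma.1 x.2
  exact ⟨(Finset.mem_Icc.1 h1).1, lRange_spec (Finset.mem_Icc.1 h1).1 h2⟩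

theorem card_pairRange {r p₀ : ℕ} (hp₀ : 1 ≤ p₀) :
    ((pairRange r p₀).card : ℚ) =
      r + ∑ i ∈ Finset.Icc 2 p₀, (((r / i : ℕ) : ℚ) - ((r / (i + 1) : ℕ) : ℚ)) := by
  rw [pairRange, Finset.card_sigma, ← Finset.insert_Icc_succ_left_eq_Icc hp₀,
    Finset.sum_insert (by simp), card_lRange_one]
  push_cast
  congr 1
  refine Finset.sum_congr rfl fun i hi => ?_
  rw [card_lRange (Finset.mem_Icc.1 hi).1, Nat.cast_sub]
  exact Nat.div_le_div_left (Nat.le_succ i) (by have := (Finset.mem_Icc.1 hi).1; omega)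

/-- The extension by `1` of a family of units. -/
def extendOne {S : Finset ℕ} (δ : S → Kˣ) (b : ℕ) : Kˣ := if h : b ∈ S then δ ⟨b, h⟩ else 1

theorem extendOne_of_mem {S : Finset ℕ} (δ : S → Kˣ) {b : ℕ} (hb : b ∈ S) :
    extendOne δ b = δ ⟨b, hb⟩ := dif_pos hb

theorem extendOne_injOn {S : Finset ℕ} {δ ε : S → Kˣ}
    (h : ∀ b ∈ S, extendOne δ b = extendOne ε b) : δ = ε := by
  funext ⟨b, hb⟩
  simpa only [extendOne_of_mem _ hb] using h b hb

variable (K) in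
/-- The parameters of the orbits in the code. -/
abbrev CodeIndex (q r p₀ : ℕ) : Type _ :=
  (pairRange r p₀ × (Finset.Icc 1 r → Kˣ) × Fin (q - 1)) ⊕
    (Σ l : Finset.Icc 1 r, ((Finset.Icc 1 r).erase (l : ℕ) → Kˣ))

/-- The coefficient of `u` in the space with given parameters. -/
noncomputable def codeFst {q r p₀ : ℕ} : CodeIndex K q r p₀ → K[X]
  | .inl x => onePoly (Finset.Icc 1 r) (extendOne x.2.1)
  | .inr y => onePoly ((Finset.Icc 1 r).erase y.1) (extendOne y.2)

/-- The coefficient of `u ^ q` in the space with given parameters. -/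
noncomputable def codeSnd {q r p₀ : ℕ} (ξ : Kˣ) : CodeIndex K q r p₀ → K[X]
  | .inl x => C ((ξ : K) ^ (x.2.2 : ℕ)) * multPoly x.1.1.1 x.1.1.2 (extendOne x.2.1)
  | .inr y => X ^ (y.1 : ℕ)

theorem C_relation_swap {A A' B B' : K[X]} {κ : K} (hκ : κ ≠ 0)
    (h : A * B' = C κ * (A' * B)) : A' * B = C κ⁻¹ * (A * B') := by
  rw [h, ← mul_assoc, ← C_mul, inv_mul_cancel₀ hκ, C_1, one_mul]

theorem not_relation_inl_inr {q r p₀ : ℕ} {ξ : Kˣ}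
    (x : pairRange r p₀ × (Finset.Icc 1 r → Kˣ) × Fin (q - 1))
    (y : Σ l : Finset.Icc 1 r, ((Finset.Icc 1 r).erase (l : ℕ) → Kˣ)) {κ : K} (hκ : κ ≠ 0)
    (h : codeFst (.inl x : CodeIndex K q r p₀) * codeSnd ξ (.inr y : CodeIndex K q r p₀) =
      C κ * (codeFst (.inr y : CodeIndex K q r p₀) * codeSnd ξ (.inl x : CodeIndex K q r p₀))) :
    False := by
  obtain ⟨hp, hl, hpl, -⟩ := pairRange_spec x.1
  refine not_relation_multPoly_X_pow (δ := extendOne x.2.1) (δ' := extendOne y.2) hp hl hpl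
    (μ := κ * (ξ : K) ^ (x.2.2 : ℕ)) (mul_ne_zero hκ (pow_ne_zero _ ξ.ne_zero)) (h.trans ?_)
  simp only [codeFst, codeSnd, C_mul]
  ring

/-- Infinite sequences `δ` repeat each space; indexing by the values that occur (all of `1, …, r`,
or all but `l` for the spaces `V`) makes the index set finite and free of repetition. -/
theorem unionCode_eq_iUnion {r p₀ : ℕ} (hp₀ : 1 ≤ p₀) (ξ : Kˣ) (γ : L) :
    unionCode F r p₀ ξ γ = ⋃ i : CodeIndex K (Nat.card F) r p₀,
      cyclicOrbit (polySpace F γ (codeFst i) (codeSnd ξ i)) := by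
  have hU : codeC F r 1 ξ γ ∪ (⋃ p ∈ Finset.Icc 2 p₀, codeC F r p ξ γ) =
      ⋃ p ∈ Finset.Icc 1 p₀, codeC F r p ξ γ := by
    rw [← Finset.insert_Icc_succ_left_eq_Icc hp₀, Finset.set_biUnion_insert]
    rfl
  rw [unionCode, hU]
  ext W
  simp only [Set.mem_union, Set.mem_iUnion, codeC, codeD]
  constructor
  · rintro (⟨p, hp, l, hl, δ, _, ⟨i, hi, rfl⟩, hW⟩ | ⟨l, hl, δ, hW⟩)
    · obtain ⟨hl1, hpl, -⟩ := lRange_spec (Finset.mem_Icc.1 hp).1 hl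
      refine ⟨.inl ⟨⟨⟨p, l⟩, Finset.mem_sigma.2 ⟨hp, hl⟩⟩, fun b => δ b, ⟨i, hi⟩⟩, ?_⟩
      have hδ : ∀ b ∈ Finset.Icc 1 r,
          extendOne (fun b : Finset.Icc 1 r => δ b) b = δ b := fun b hb => extendOne_of_mem _ hb
      simp only [codeFst, codeSnd]
      rw [onePoly_congr hδ, multPoly_congr hl1 hpl hδ, ← subspaceU_eq_polySpace hl1 hpl]
      exact hW
    · refine ⟨.inr ⟨⟨l, hl⟩, fun b => δ b⟩, ?_⟩
      simp only [codeFst, codeSnd]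
      rw [onePoly_congr (ε := δ) fun b hb => extendOne_of_mem _ hb, ← subspaceV_eq_polySpace]
      exact hW
  · rintro ⟨⟨x, δ, i⟩ | ⟨l, δ⟩, hW⟩
    · obtain ⟨-, hl, hpl, -⟩ := pairRange_spec x
      obtain ⟨h1, h2⟩ := Finset.mem_sigma.1 x.2
      refine Or.inl ⟨_, h1, _, h2, extendOne δ, _, ⟨i, i.2, rfl⟩, ?_⟩
      rw [subspaceU_eq_polySpace hl hpl]
      exact hW
    · refine Or.inr ⟨l, l.2, extendOne δ, ?_⟩
      rw [subspaceV_eq_polySpace]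
      exact hW

theorem card_codeIndex [Finite K] (q r p₀ : ℕ) :
    Nat.card (CodeIndex K q r p₀) = (pairRange r p₀).card * ((Nat.card Kˣ) ^ r * (q - 1)) +
      r * (Nat.card Kˣ) ^ (r - 1) := by
  have hS : ∀ {α : Type} (S : Finset α), Nat.card S = S.card := fun S => by
    rw [Nat.card_eq_fintype_card, Fintype.card_coe]
  have h : ∀ l : Finset.Icc 1 r,
      Nat.card ((Finset.Icc 1 r).erase (l : ℕ) → Kˣ) = (Nat.card Kˣ) ^ (r - 1) := by
    intro l
    rw [Nat.card_fun, hS, Finset.card_erase_of_mem l.2, Nat.card_Icc]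
    simp
  rw [Nat.card_sum, Nat.card_prod, Nat.card_prod, Nat.card_sigma, Finset.sum_congr rfl fun l _ => h l]
  rw [hS, Nat.card_fun, hS, Nat.card_fin]
  simp

end Family

theorem isGoodFamily_code {F K : Type*} [Field F] [Field K] [Finite K] {r p₀ : ℕ} {ξ : Kˣ}
    (hξ : ∀ x : Kˣ, x ∈ Subgroup.zpowers ξ) (hdvd : Nat.card F - 1 ∣ Nat.card Kˣ) :
    IsGoodFamily F r (codeFst : CodeIndex K (Nat.card F) r p₀ → K[X]) (codeSnd ξ) where
  good := by
    rintro (⟨x, δ, i⟩ | ⟨l, δ⟩)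
    · obtain ⟨hp, hl, hpl, -⟩ := pairRange_spec x
      exact isGoodPair_multPoly hp hl hpl _ (pow_ne_zero _ ξ.ne_zero)
    · exact isGoodPair_X_pow l.2 _
  eq_of_relation := by
    intro x y c hc h
    have hκ : c ^ (Nat.card F - 1) ≠ 0 := pow_ne_zero _ hc
    rcases x with ⟨x, δ, i⟩ | ⟨l, δ⟩ <;> rcases y with ⟨y, ε, j⟩ | ⟨m, ε⟩
    · obtain ⟨hp, hl, hpl, hr⟩ := pairRange_spec x
      obtain ⟨hp', hl', -, -⟩ := pairRange_spec y
      have hξj : (ξ : K) ^ (j : ℕ) ≠ 0 := pow_ne_zero _ ξ.ne_zero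
      obtain ⟨h1, h2, h3, h4⟩ := eq_of_relation_multPoly hp hl hpl hr hp' hl'
        (δ := extendOne δ) (δ' := extendOne ε)
        (μ := c ^ (Nat.card F - 1) * (ξ : K) ^ (i : ℕ) * ((ξ : K) ^ (j : ℕ))⁻¹)
        (mul_ne_zero (mul_ne_zero hκ (pow_ne_zero _ ξ.ne_zero)) (inv_ne_zero hξj)) (by
          have h5 : C ((ξ : K) ^ (j : ℕ))⁻¹ * C ((ξ : K) ^ (j : ℕ)) = 1 := by
            rw [← C_mul, inv_mul_cancel₀ hξj, C_1]
          simp only [codeFst, codeSnd] at h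
          simp only [C_mul] at h ⊢
          linear_combination C ((ξ : K) ^ (j : ℕ))⁻¹ * h -
            onePoly (Finset.Icc 1 r) (extendOne δ) * multPoly y.1.1 y.1.2 (extendOne ε) * h5)
      obtain rfl : x = y := Subtype.ext (Sigma.ext h1 (heq_of_eq h2))
      obtain rfl := extendOne_injOn h3
      -- The scalar absorbing both `θ`'s equals `1`, that is, `c^(q-1) ξ^i = ξ^j`.
      rw [mul_inv_eq_one₀ hξj] at h4
      obtain rfl : i = j := Fin.ext (eq_of_pow_mul_pow_eq hξ hdvd i.2 j.2 hc h4)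
      rfl
    · exact (not_relation_inl_inr _ _ hκ h).elim
    · exact (not_relation_inl_inr _ _ (inv_ne_zero hκ) (C_relation_swap hκ h)).elim
    · obtain ⟨h1, h2⟩ := eq_of_relation_X_pow hκ h
      obtain rfl : l = m := Subtype.ext h1
      obtain rfl := extendOne_injOn h2
      rfl

theorem theorem3p3
    {F K L : Type*} [Field F] [Finite F] [Field K] [Field L]
    [Algebra F K] [Algebra K L] [Algebra F L] [IsScalarTower F K L]
    (q k r n p₀ : ℕ) (hk : 2 ≤ k) (hr : 2 ≤ r) (hn : n = (2 * r + 1) * k)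
    (hF : Nat.card F = q) (hK : Module.finrank F K = k) (hL : Module.finrank F L = n)
    -- `p₀` is the largest positive `i` with `⌊r / i⌋ > ⌊r / (i + 1)⌋`
    (hp₀ : IsGreatest {i : ℕ | 1 ≤ i ∧ r / (i + 1) < r / i} p₀)
    -- `ξ` is a primitive element of `K`
    (ξ : Kˣ) (hξ : ∀ x : Kˣ, x ∈ Subgroup.zpowers ξ)
    (γ : L) (hγ : ∃ P : Polynomial K,
      Irreducible P ∧ P.natDegree = 2 * r + 1 ∧ Polynomial.aeval γ P = 0) :
    (∀ p ∈ Finset.Icc 1 p₀, ∀ l ∈ lRange r p, ∀ δ : ℕ → Kˣ, ∀ θ ∈ thetaSet F ξ,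
      IsSidonSpace (subspaceU F r p l δ θ γ)) ∧
    (∀ l ∈ Finset.Icc 1 r, ∀ δ : ℕ → Kˣ, IsSidonSpace (subspaceV F r l δ γ)) ∧
    IsCyclicCDC q n (2 * (k : ℤ) - 2) k (unionCode F r p₀ ξ γ) ∧
    ((unionCode F r p₀ ξ γ).ncard : ℚ) =
      (((r : ℚ) + ∑ i ∈ Finset.Icc 2 p₀, (((r / i : ℕ) : ℚ) - ((r / (i + 1) : ℕ) : ℚ)))
            * ((q : ℚ) ^ k - 1) * ((q : ℚ) - 1) + r)
          * ((q : ℚ) ^ k - 1) ^ (r - 1) * ((q : ℚ) ^ n - 1) / ((q : ℚ) - 1) := by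
  obtain ⟨P, hP, hd, hγ⟩ := hγ
  have hn0 : 0 < n := by rw [hn]; positivity
  have : FiniteDimensional F K := Module.finite_of_finrank_pos (by omega)
  have : FiniteDimensional F L := Module.finite_of_finrank_pos (by omega)
  have : Finite K := Module.finite_of_finite F
  have : Finite L := Module.finite_of_finite F
  have hcK : Nat.card K = q ^ k := by rw [← hF, ← hK, Module.natCard_eq_pow_finrank (K := F)]
  have hcL : Nat.card L = q ^ n := by rw [← hF, ← hL, Module.natCard_eq_pow_finrank (K := F)]
  have hq : 1 < q := hF ▸ Finite.one_lt_card
  have hcK' : Nat.card Kˣ = q ^ k - 1 := by rw [Nat.card_units, hcK]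
  have hp1 : 1 ≤ p₀ := hp₀.1.1
  have hfam : IsGoodFamily F r (codeFst : CodeIndex K (Nat.card F) r p₀ → K[X]) (codeSnd ξ) :=
    isGoodFamily_code hξ (by
      rw [hcK', hF]
      -- This is `q - 1 ∣ q^k - 1`.
      simpa using Nat.sub_dvd_pow_sub_pow q 1 k)
  have hne : Nonempty (CodeIndex K (Nat.card F) r p₀) :=
    ⟨.inr ⟨⟨1, by simp; omega⟩, fun _ => 1⟩⟩
  refine ⟨?_, ?_, ?_, ?_⟩
  · rintro p hp l hl δ _ ⟨i, -, rfl⟩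
    have hp' := (Finset.mem_Icc.1 hp).1
    obtain ⟨hl1, hpl, -⟩ := lRange_spec hp' hl
    rw [subspaceU_eq_polySpace hl1 hpl]
    exact (isGoodPair_multPoly hp' hl1 hpl δ (pow_ne_zero _ ξ.ne_zero)).isSidonSpace hP hd hγ
  · intro l hl δ
    rw [subspaceV_eq_polySpace]
    exact (isGoodPair_X_pow hl δ).isSidonSpace hP hd hγ
  · have := hfam.isCyclicCDC hP hd hγ (by omega)
    rwa [hF, hK, hL, ← hF, ← unionCode_eq_iUnion hp1, hF] at this
  · have := hfam.ncard_iUnion hP hd hγ (by omega)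
    rw [← unionCode_eq_iUnion hp1, card_codeIndex, hF, hcK', hcL] at this
    have hqQ : (q : ℚ) - 1 ≠ 0 := by
      have : (1 : ℚ) < q := by exact_mod_cast hq
      linarith
    rw [eq_div_iff hqQ, ← card_pairRange hp1]
    have hc := congrArg (Nat.cast : ℕ → ℚ) this
    push_cast [Nat.cast_sub hq.le, Nat.cast_sub (Nat.one_le_pow k q (by omega)),
      Nat.cast_sub (Nat.one_le_pow n q (by omega))] at hc
    rw [hc]
    -- Writing `r = e + 1` lets the common factor `(q^k - 1)^(r-1)` be taken out of both kinds of
    -- parameters.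
    obtain ⟨e, rfl⟩ : ∃ e, r = e + 1 := ⟨r - 1, by omega⟩
    rw [Nat.add_sub_cancel, pow_succ]
    ring
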